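/- Let $d\ge 1$ and let $\phi:(0,\infty)\to(0,\infty)$ be a Bernstein function with $\phi(0+)=0$, without drift, and with $\phi(1)=1$, that is, $\phi(\lambda)=\int_{(0,\infty)}(1-e^{-\lambda s})\,\mu(ds)$ for all $\lambda>0$, where $\mu$ is a measure on $(0,\infty)$ with $\int_{(0,\infty)}(1\wedge s)\,\mu(ds)<\infty$. Suppose that $\phi$ satisfies (H1) there are constants $0<\delta_1\le\delta_2<1$ and $a_1,a_2>0$ such that $a_1\lambda^{\delta_1}\phi(t)\le\phi(\lambda t)\le a_2\lambda^{\delta_2}\phi(t)$ for all $\lambda\ge1$, $t\ge1$. Let $S=(S_t)_{t\ge0}$ be a subordinator (an increasing Lévy process with values in $[0,\infty)$ and $S_0=0$) with Laplace exponent $\phi$, i.e. $\mathbb E[e^{-\lambda S_t}]=e^{-t\phi(\lambda)}$ for $\lambda>0$, let $W=(W_t)_{t\ge0}$ be a Brownian motion in $\mathbb R^d$ independent of $S$, with $W_0=0$ and $\mathbb E[e^{i\xi\cdot W_t}]=e^{-t|\xi|^2}$, and let $X_t:=W_{S_t}$ be the subordinate Brownian motion. For $t>0$ let $$p(t,x)=(2\pi)^{-d}\int_{\mathbb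 R^d}e^{i\xi\cdot x}e^{-t\phi(|\xi|^2)}\,d\xi ,\qquad x\in\mathbb R^d.$$ Then $p$ is the transition density of $X$, i.e. for all $s\ge0$ and $t>0$ the increment $X_{s+t}-X_s$ has density $p(t,\cdot)$ with respect to Lebesgue measure, and for each $T>0$ there is a constant $N=N(T,d,\phi)>0$ such that for all $(t,x)\in(0,T]\times\mathbb R^d$ $$p(t,x)\le N\left(\left(\phi^{-1}(t^{-1})\right)^{d/2}\wedge t\,\frac{\phi(|x|^{-2})}{|x|^d}\right),$$ where $\phi^{-1}$ is the inverse of $\phi:(0,\infty)\to(0,\infty)$ and, for $x=0$, the second term of the minimum is read as $+\infty$. -/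

import Mathlib

open MeasureTheory ProbabilityTheory Filter Topology
open scoped NNReal ENNReal

noncomputable section

namespace SubordinateBM

/-- A Lévy measure of a subordinator: a measure carried by `(0, ∞)` with
`∫ (1 ∧ t) μ(dt) < ∞`. -/
structure IsLevyMeasure (μ : Measure ℝ) : Prop where
  carrier : μ (Set.Iic 0) = 0
  finite : ∫⁻ t, ENNReal.ofReal (min 1 t) ∂μ < ∞

/-- `φ` is, on `(0, ∞)`, the Bernstein function with `φ(0+) = 0`, drift `b` and Lévy measure `μ`:
`φ(l) = b l + ∫ (1 - e^{-l t}) μ(dt)`. The values of `φ` on `(-∞, 0]` are irrelevant. -/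
structure IsBernsteinWith (φ : ℝ → ℝ) (b : ℝ) (μ : Measure ℝ) : Prop where
  drift_nonneg : 0 ≤ b
  levy : IsLevyMeasure μ
  repr : ∀ l : ℝ, 0 < l → φ l = b * l + ∫ t, (1 - Real.exp (-(l * t))) ∂μ

/-- A Bernstein function with `φ(0+) = 0` and no drift. -/
def IsDriftlessBernstein (φ : ℝ → ℝ) : Prop :=
  ∃ μ : Measure ℝ, IsBernsteinWith φ 0 μ

/-- Condition (H1): weak scaling of `φ` at infinity. -/
def H1 (φ : ℝ → ℝ) : Prop :=
  ∃ δ₁ δ₂ a₁ a₂ : ℝ, 0 < δ₁ ∧ δ₁ ≤ δ₂ ∧ δ₂ < 1 ∧ 0 < a₁ ∧ 0 < a₂ ∧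
    ∀ l t : ℝ, 1 ≤ l → 1 ≤ t →
      a₁ * l ^ δ₁ * φ t ≤ φ (l * t) ∧ φ (l * t) ≤ a₂ * l ^ δ₂ * φ t

/-- The inverse of `φ` as a function on `(0, ∞)`. -/
def inverse (φ : ℝ → ℝ) : ℝ → ℝ :=
  Function.invFunOn φ (Set.Ioi 0)

variable {Ω : Type*} [MeasurableSpace Ω]

/-- A subordinator: a Lévy process with values in `[0, ∞)`, started at `0`, with increasing
paths. The paths are right-continuous; being increasing, they have left limits. -/
structure IsSubordinator (S : ℝ≥0 → Ω → ℝ≥0) (P : Measure Ω) : Prop where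
  measurable : ∀ t, Measurable (S t)
  zero : ∀ᵐ ω ∂P, S 0 ω = 0
  indep : HasIndepIncrements (fun t ω => (S t ω : ℝ)) P
  stationary : ∀ s t : ℝ≥0,
    P.map (fun ω => (S (s + t) ω : ℝ) - S s ω) = P.map (fun ω => (S t ω : ℝ))
  monotone : ∀ᵐ ω ∂P, Monotone (fun t => S t ω)
  rightCont : ∀ᵐ ω ∂P, ∀ t, ContinuousWithinAt (fun r => S r ω) (Set.Ici t) t

/-- `φ` is the Laplace exponent of `S`: `E[exp(-l S_t)] = exp(-t φ(l))` for `l > 0`. -/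
def HasLaplaceExponent (S : ℝ≥0 → Ω → ℝ≥0) (P : Measure Ω) (φ : ℝ → ℝ) : Prop :=
  ∀ (t : ℝ≥0) (l : ℝ), 0 < l →
    ∫ ω, Real.exp (-(l * (S t ω : ℝ))) ∂P = Real.exp (-((t : ℝ) * φ l))

/-- A `d`-dimensional Brownian motion started at `0`, run at twice the usual speed:
`E[exp(i ξ · (W_{s+t} - W_s))] = exp(-t |ξ|²)`. -/
structure IsBrownianMotion {d : ℕ} (W : ℝ≥0 → Ω → EuclideanSpace ℝ (Fin d))
    (P : Measure Ω) : Prop where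
  measurable : ∀ t, Measurable (W t)
  zero : ∀ᵐ ω ∂P, W 0 ω = 0
  indep : HasIndepIncrements W P
  charFun_increment : ∀ (s t : ℝ≥0) (ξ : EuclideanSpace ℝ (Fin d)),
    charFun (P.map (fun ω => W (s + t) ω - W s ω)) ξ = Complex.exp (-((t : ℝ) * ‖ξ‖ ^ 2 : ℝ))
  continuous : ∀ᵐ ω ∂P, Continuous (fun t => W t ω)

/-- The subordinate process `X_t = W_{S_t}`. -/
def subordinate {d : ℕ} (W : ℝ≥0 → Ω → EuclideanSpace ℝ (Fin d)) (S : ℝ≥0 → Ω → ℝ≥0)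
    (t : ℝ≥0) (ω : Ω) : EuclideanSpace ℝ (Fin d) :=
  W (S t ω) ω

/-- `p(t,x) = (2π)^{-d} ∫ e^{i ξ · x} e^{-t φ(|ξ|²)} dξ`. The integral is real by symmetry. -/
def transitionDensity {d : ℕ} (φ : ℝ → ℝ) (t : ℝ) (x : EuclideanSpace ℝ (Fin d)) : ℝ :=
  ((2 * Real.pi) ^ d)⁻¹ *
    (∫ ξ : EuclideanSpace ℝ (Fin d),
      Complex.exp (Complex.I * (inner ℝ ξ x : ℝ)) *
        (Real.exp (-(t * φ (‖ξ‖ ^ 2))) : ℂ)).re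

end SubordinateBM

end

/-!
Conditionally on `S`, the increment `X_{s+t} - X_s` is Gaussian, so its law is the mixture of the
heat kernels over the law of `S_t`; Fourier inversion identifies the density of this mixture with
`p(t, ·)`.

On the diagonal, `p(t, x) ≤ ∫ exp (-t φ(|ξ|²)) dξ`. With `R = φ⁻¹(1/t)`, lower scaling beyond `R`
gives `t φ(|ξ|²) = φ(|ξ|²) / φ(R) ≥ c (|ξ|² / R) ^ δ - c`, and the substitution `ξ = √R η` produces
the factor `R ^ (d/2)`. Away from the diagonal, every heat kernel satisfies
`heatKernel s x ≤ K |x|⁻ᵈ (1 - exp (-s / |x|²))`; averaging over the law of `S_t` turns the last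
factor into `1 - exp (-t φ(|x|⁻²)) ≤ t φ(|x|⁻²)`.
-/

namespace SubordinateBM

section BernsteinFunction

variable {μ : Measure ℝ} {φ : ℝ → ℝ} {b : ℝ}

lemma IsLevyMeasure.ae_pos (hμ : IsLevyMeasure μ) : ∀ᵐ s ∂μ, 0 < s := by
  rw [ae_iff]
  simp only [not_lt]
  exact hμ.carrier

lemma IsLevyMeasure.integrable_min_one (hμ : IsLevyMeasure μ) :
    Integrable (fun s : ℝ => min 1 s) μ := by
  refine ⟨by fun_prop, ?_⟩
  rw [hasFiniteIntegral_iff_ofReal (hμ.ae_pos.mono fun s hs => le_min zero_le_one hs.le)]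
  exact hμ.finite

lemma one_sub_exp_neg_nonneg {u : ℝ} (hu : 0 ≤ u) : 0 ≤ 1 - Real.exp (-u) :=
  sub_nonneg.2 (Real.exp_le_one_iff.2 (neg_nonpos.2 hu))

lemma norm_one_sub_exp_neg_mul_le {l m s : ℝ} (hl : 0 ≤ l) (hlm : l ≤ m) (hm : 1 ≤ m)
    (hs : 0 ≤ s) : ‖1 - Real.exp (-(l * s))‖ ≤ m * min 1 s := by
  rw [Real.norm_of_nonneg (one_sub_exp_neg_nonneg (mul_nonneg hl hs)),
    mul_min_of_nonneg _ _ (zero_le_one.trans hm), mul_one, le_min_iff]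
  constructor
  · linarith [Real.exp_pos (-(l * s))]
  · linarith [Real.add_one_le_exp (-(l * s)), mul_le_mul_of_nonneg_right hlm hs]

lemma IsLevyMeasure.integrable_one_sub_exp_neg_mul (hμ : IsLevyMeasure μ) {l : ℝ} (hl : 0 ≤ l) :
    Integrable (fun s => 1 - Real.exp (-(l * s))) μ :=
  (hμ.integrable_min_one.const_mul (max 1 l)).mono' (by fun_prop) <| hμ.ae_pos.mono fun _ hs =>
    norm_one_sub_exp_neg_mul_le hl (le_max_right _ _) (le_max_left _ _) hs.le

lemma IsLevyMeasure.continuousOn_integral (hμ : IsLevyMeasure μ) :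
    ContinuousOn (fun l : ℝ => ∫ s, (1 - Real.exp (-(l * s))) ∂μ) (Set.Ici 0) := by
  intro l _
  refine continuousWithinAt_of_dominated (bound := fun s => max 1 (l + 1) * min 1 s)
    (Eventually.of_forall fun _ => by fun_prop) ?_ (hμ.integrable_min_one.const_mul _)
    (Eventually.of_forall fun _ => by fun_prop)
  filter_upwards [mem_nhdsWithin_of_mem_nhds (Iio_mem_nhds (lt_add_one l)), self_mem_nhdsWithin]
    with m hml hm
  filter_upwards [hμ.ae_pos] with s hs
  exact norm_one_sub_exp_neg_mul_le hm (hml.le.trans (le_max_right _ _)) (le_max_left _ _) hs.le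

namespace IsBernsteinWith

lemma nonneg (hφ : IsBernsteinWith φ b μ) {l : ℝ} (hl : 0 < l) : 0 ≤ φ l := by
  rw [hφ.repr l hl]
  exact add_nonneg (mul_nonneg hφ.drift_nonneg hl.le) <| integral_nonneg_of_ae <|
    hφ.levy.ae_pos.mono fun _ hs => one_sub_exp_neg_nonneg (mul_pos hl hs).le

lemma monotoneOn (hφ : IsBernsteinWith φ b μ) : MonotoneOn φ (Set.Ioi 0) := by
  intro l hl m hm hlm
  rw [hφ.repr l hl, hφ.repr m hm]
  refine add_le_add (mul_le_mul_of_nonneg_left hlm hφ.drift_nonneg) <|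
    integral_mono_ae (hφ.levy.integrable_one_sub_exp_neg_mul (le_of_lt hl))
      (hφ.levy.integrable_one_sub_exp_neg_mul (le_of_lt hm)) ?_
  filter_upwards [hφ.levy.ae_pos] with s hs
  gcongr

lemma continuousOn_repr (hφ : IsBernsteinWith φ b μ) :
    ContinuousOn (fun l => b * l + ∫ s, (1 - Real.exp (-(l * s))) ∂μ) (Set.Ici 0) :=
  ContinuousOn.add (by fun_prop) hφ.levy.continuousOn_integral

lemma continuousOn (hφ : IsBernsteinWith φ b μ) : ContinuousOn φ (Set.Ioi 0) :=
  (hφ.continuousOn_repr.mono Set.Ioi_subset_Ici_self).congr hφ.repr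

lemma tendsto_nhdsGT_zero (hφ : IsBernsteinWith φ b μ) : Tendsto φ (𝓝[>] 0) (𝓝 0) := by
  have h0 : Tendsto (fun l => b * l + ∫ s, (1 - Real.exp (-(l * s))) ∂μ) (𝓝[≥] 0) (𝓝 0) := by
    simpa using (hφ.continuousOn_repr 0 Set.self_mem_Ici).tendsto
  refine (h0.mono_left (nhdsWithin_mono _ Set.Ioi_subset_Ici_self)).congr' ?_
  filter_upwards [self_mem_nhdsWithin] with l hl using (hφ.repr l hl).symm

lemma surjOn (hφ : IsBernsteinWith φ b μ) (htop : Tendsto φ atTop atTop) :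
    Set.SurjOn φ (Set.Ioi 0) (Set.Ioi 0) :=
  isPreconnected_Ioi.intermediate_value_Ioi (l₁ := 𝓝[>] (0 : ℝ)) inf_le_right
    (le_principal_iff.2 (Ioi_mem_atTop 0)) hφ.continuousOn hφ.tendsto_nhdsGT_zero htop

lemma inverse_pos (hφ : IsBernsteinWith φ b μ) (htop : Tendsto φ atTop atTop) {y : ℝ}
    (hy : 0 < y) : 0 < inverse φ y :=
  (hφ.surjOn htop).mapsTo_invFunOn hy

lemma apply_inverse (hφ : IsBernsteinWith φ b μ) (htop : Tendsto φ atTop atTop) {y : ℝ}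
    (hy : 0 < y) : φ (inverse φ y) = y :=
  (hφ.surjOn htop).rightInvOn_invFunOn hy

lemma lt_inverse (hφ : IsBernsteinWith φ b μ) (htop : Tendsto φ atTop atTop) {r y : ℝ}
    (hr : 0 < r) (hy : φ r < y) : r < inverse φ y := by
  have hy₀ : 0 < y := (hφ.nonneg hr).trans_lt hy
  exact hφ.monotoneOn.reflect_lt hr (hφ.inverse_pos htop hy₀) (hy.trans_eq
    (hφ.apply_inverse htop hy₀).symm)

end IsBernsteinWith

end BernsteinFunction

section LowerScaling

/-- The weak lower scaling condition of order `δ` beyond the threshold `θ`, the lower half of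
`H1`. The threshold is a parameter because small `t⁻¹` require one below `1`. -/
def LowerScaling (φ : ℝ → ℝ) (δ a θ : ℝ) : Prop :=
  ∀ l t : ℝ, 1 ≤ l → θ ≤ t → a * l ^ δ * φ t ≤ φ (l * t)

variable {φ : ℝ → ℝ} {δ a θ : ℝ}

namespace LowerScaling

lemma mul_rpow_div_le (h : LowerScaling φ δ a θ) {t x : ℝ} (ht₀ : 0 < t) (ht : θ ≤ t)
    (hx : t ≤ x) : a * (x / t) ^ δ * φ t ≤ φ x := by
  simpa only [div_mul_cancel₀ x ht₀.ne'] using h (x / t) t ((one_le_div ht₀).2 hx) ht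

lemma tendsto_atTop (h : LowerScaling φ δ a θ) (hδ : 0 < δ) (ha : 0 < a) (hθ : 0 < θ)
    (hφθ : 0 < φ θ) : Tendsto φ atTop atTop := by
  have hrpow : Tendsto (fun x => a * (x / θ) ^ δ * φ θ) atTop atTop :=
    (((tendsto_rpow_atTop hδ).comp (tendsto_id.atTop_div_const hθ)).const_mul_atTop
      ha).atTop_mul_const hφθ
  refine tendsto_atTop_mono' _ ?_ hrpow
  filter_upwards [eventually_ge_atTop θ] with x hx using h.mul_rpow_div_le hθ le_rfl hx

lemma le_one (h : LowerScaling φ δ a θ) (hφθ : 0 < φ θ) : a ≤ 1 := by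
  have := h 1 θ le_rfl le_rfl
  rw [Real.one_rpow, mul_one, one_mul] at this
  exact (mul_le_iff_le_one_left hφθ).1 this

lemma extend (h : LowerScaling φ δ a θ) (hmono : MonotoneOn φ (Set.Ioi 0))
    (hnonneg : ∀ x, 0 < x → 0 ≤ φ x) (hδ : 0 ≤ δ) (ha : 0 ≤ a) (hφθ : 0 < φ θ) {r : ℝ}
    (hr : 0 < r) (hrθ : r ≤ θ) : LowerScaling φ δ (a * (r / θ) ^ δ) r := by
  have hθ : 0 < θ := hr.trans_le hrθ
  intro l t hl hrt
  have hl₀ : 0 < l := one_pos.trans_le hl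
  have ht : 0 < t := hr.trans_le hrt
  have hφt : 0 ≤ φ t := hnonneg t ht
  have hfactor : (r / θ) ^ δ * l ^ δ = (l * r / θ) ^ δ := by
    rw [← Real.mul_rpow (by positivity) hl₀.le]
    ring_nf
  rw [mul_assoc a, hfactor]
  rcases le_total θ t with hθt | htθ
  · refine le_trans ?_ (h l t hl hθt)
    gcongr
    rw [div_le_iff₀ hθ]
    gcongr
  rcases le_total θ (l * t) with hθlt | hltθ
  · calc a * (l * r / θ) ^ δ * φ t ≤ a * (l * t / θ) ^ δ * φ θ := by
          gcongr
          exact hmono ht hθ htθ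
      _ ≤ φ (l * t) := h.mul_rpow_div_le hθ le_rfl hθlt
  · have hratio : (l * r / θ) ^ δ ≤ 1 :=
      Real.rpow_le_one (by positivity) ((div_le_one hθ).2 (le_trans (by gcongr) hltθ)) hδ
    calc a * (l * r / θ) ^ δ * φ t ≤ 1 * 1 * φ t := by
          gcongr
          exact h.le_one hφθ
      _ = φ t := by ring
      _ ≤ φ (l * t) := hmono ht (mul_pos hl₀ ht) (le_mul_of_one_le_left ht.le hl)

lemma mul_rpow_div_le_div_add (h : LowerScaling φ δ a θ) (hδ : 0 ≤ δ) (ha : 0 ≤ a) {t x : ℝ}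
    (ht₀ : 0 < t) (ht : θ ≤ t) (hφt : 0 < φ t) (hx : 0 ≤ x) (hφx : 0 ≤ φ x) :
    a * (x / t) ^ δ ≤ φ x / φ t + a := by
  rcases le_total t x with htx | hxt
  · refine le_add_of_le_of_nonneg ?_ ha
    exact (le_div_iff₀ hφt).2 (h.mul_rpow_div_le ht₀ ht htx)
  · refine le_add_of_nonneg_of_le (by positivity) (mul_le_of_le_one_right ha ?_)
    exact Real.rpow_le_one (by positivity) ((div_le_one ht₀).2 hxt) hδ

end LowerScaling

lemma IsBernsteinWith.exists_mul_rpow_div_inverse_le {b : ℝ} {μ : Measure ℝ}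
    (hφ : IsBernsteinWith φ b μ) (hscal : LowerScaling φ δ a θ) (hδ : 0 < δ) (ha : 0 < a)
    (hθ : 0 < θ) (hφθ : 0 < φ θ) {T : ℝ} (hT : 0 < T) :
    ∃ c : ℝ, 0 < c ∧ ∀ t : ℝ, 0 < t → t ≤ T → ∀ x : ℝ, 0 < x →
      c * (x / inverse φ t⁻¹) ^ δ ≤ t * φ x + c := by
  have htop : Tendsto φ atTop atTop := hscal.tendsto_atTop hδ ha hθ hφθ
  obtain ⟨r, ⟨hφr, hrθ⟩, hr⟩ : ∃ r, (φ r < T⁻¹ ∧ r < θ) ∧ 0 < r :=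
    (((hφ.tendsto_nhdsGT_zero.eventually_lt_const (inv_pos.2 hT)).and
      (mem_nhdsWithin_of_mem_nhds (Iio_mem_nhds hθ))).and self_mem_nhdsWithin).exists
  have hscal_r : LowerScaling φ δ (a * (r / θ) ^ δ) r :=
    hscal.extend hφ.monotoneOn (fun _ => hφ.nonneg) hδ.le ha.le hφθ hr hrθ.le
  refine ⟨a * (r / θ) ^ δ, by positivity, fun t ht htT x hx => ?_⟩
  have hR : φ (inverse φ t⁻¹) = t⁻¹ := hφ.apply_inverse htop (inv_pos.2 ht)
  have hrR : r ≤ inverse φ t⁻¹ := (hφ.lt_inverse htop hr (hφr.trans_le (inv_anti₀ ht htT))).le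
  have := hscal_r.mul_rpow_div_le_div_add hδ.le (by positivity) (hr.trans_le hrR) hrR
    (hR.symm ▸ inv_pos.2 ht) hx.le (hφ.nonneg hx)
  rwa [hR, div_inv_eq_mul, mul_comm (φ x)] at this

end LowerScaling

section Symbol

variable {E : Type*} [NormedAddCommGroup E] [NormedSpace ℝ E] {ψ : ℝ → ℝ} {c δ R : ℝ}

lemma exp_neg_comp_sq_norm_le (hR : 0 < R)
    (hψ : ∀ x, 0 < x → c * (x / R) ^ δ ≤ ψ x + c) {ξ : E} (hξ : ξ ≠ 0) :
    Real.exp (-ψ (‖ξ‖ ^ 2)) ≤ Real.exp (c - c * ‖(√R)⁻¹ • ξ‖ ^ (2 * δ)) := by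
  have hnorm : ‖(√R)⁻¹ • ξ‖ ^ (2 * δ) = (‖ξ‖ ^ 2 / R) ^ δ := by
    rw [Real.rpow_mul (norm_nonneg _), Real.rpow_two, norm_smul, mul_pow, norm_inv,
      Real.norm_of_nonneg (Real.sqrt_nonneg R), inv_pow, Real.sq_sqrt hR.le, inv_mul_eq_div]
  rw [hnorm, Real.exp_le_exp]
  linarith [hψ (‖ξ‖ ^ 2) (pow_pos (norm_pos_iff.2 hξ) 2)]

variable [FiniteDimensional ℝ E] [MeasurableSpace E] [BorelSpace E] [Nontrivial E]
  (μ : Measure E) [μ.IsAddHaarMeasure]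

lemma integrable_exp_sub_mul_norm_rpow (hc : 0 < c) {p : ℝ} (hp : 0 < p) :
    Integrable (fun ξ : E => Real.exp (c - c * ‖ξ‖ ^ p)) μ := by
  have hdim : (-1 : ℝ) < ((Module.finrank ℝ E - 1 : ℕ) : ℝ) :=
    neg_one_lt_zero.trans_le (Nat.cast_nonneg _)
  have hradial : Integrable (fun ξ : E => Real.exp (-c * ‖ξ‖ ^ p)) μ := by
    rw [integrable_fun_norm_addHaar μ (f := fun r => Real.exp (-c * r ^ p))]
    simpa only [Real.rpow_natCast, smul_eq_mul] using
      integrableOn_rpow_mul_exp_neg_mul_rpow hdim hp hc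
  simpa only [sub_eq_add_neg, Real.exp_add, neg_mul] using hradial.const_mul (Real.exp c)

lemma aestronglyMeasurable_comp_sq_norm (hψ : ContinuousOn ψ (Set.Ioi 0)) :
    AEStronglyMeasurable (fun ξ : E => ψ (‖ξ‖ ^ 2)) μ := by
  have hcont : ContinuousOn (fun ξ : E => ψ (‖ξ‖ ^ 2)) {0}ᶜ :=
    hψ.comp (by fun_prop) fun ξ hξ => pow_pos (norm_pos_iff.2 hξ) 2
  have hmeas := hcont.aestronglyMeasurable (μ := μ) (measurableSet_singleton 0).compl
  rwa [Measure.restrict_eq_self_of_ae_mem (s := {0}ᶜ) (Measure.ae_ne μ 0)] at hmeas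

lemma integrable_exp_neg_comp_sq_norm (hcont : ContinuousOn ψ (Set.Ioi 0)) (hc : 0 < c)
    (hδ : 0 < δ) (hR : 0 < R) (hψ : ∀ x, 0 < x → c * (x / R) ^ δ ≤ ψ x + c) :
    Integrable (fun ξ : E => Real.exp (-ψ (‖ξ‖ ^ 2))) μ := by
  have hdom := (integrable_exp_sub_mul_norm_rpow μ hc (mul_pos two_pos hδ)).comp_smul
    (inv_pos.2 (Real.sqrt_pos.2 hR)).ne'
  refine hdom.mono' (Real.continuous_exp.comp_aestronglyMeasurable
    (aestronglyMeasurable_comp_sq_norm μ hcont).neg) ?_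
  filter_upwards [Measure.ae_ne μ 0] with ξ hξ
  rw [Real.norm_of_nonneg (Real.exp_pos _).le]
  exact exp_neg_comp_sq_norm_le hR hψ hξ

lemma integral_exp_neg_comp_sq_norm_le (hc : 0 < c) (hδ : 0 < δ) (hR : 0 < R)
    (hψ : ∀ x, 0 < x → c * (x / R) ^ δ ≤ ψ x + c) :
    ∫ ξ : E, Real.exp (-ψ (‖ξ‖ ^ 2)) ∂μ ≤
      (∫ ξ : E, Real.exp (c - c * ‖ξ‖ ^ (2 * δ)) ∂μ) * R ^ ((Module.finrank ℝ E : ℝ) / 2) := by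
  have hdom := (integrable_exp_sub_mul_norm_rpow μ hc (mul_pos two_pos hδ)).comp_smul
    (inv_pos.2 (Real.sqrt_pos.2 hR)).ne'
  calc ∫ ξ : E, Real.exp (-ψ (‖ξ‖ ^ 2)) ∂μ
      ≤ ∫ ξ : E, Real.exp (c - c * ‖(√R)⁻¹ • ξ‖ ^ (2 * δ)) ∂μ :=
        integral_mono_of_nonneg (Eventually.of_forall fun _ => (Real.exp_pos _).le) hdom <|
          (Measure.ae_ne μ 0).mono fun _ => exp_neg_comp_sq_norm_le hR hψ
    _ = √R ^ Module.finrank ℝ E * ∫ ξ : E, Real.exp (c - c * ‖ξ‖ ^ (2 * δ)) ∂μ := by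
        rw [Measure.integral_comp_inv_smul_of_nonneg μ
          (fun ξ => Real.exp (c - c * ‖ξ‖ ^ (2 * δ))) (Real.sqrt_nonneg R), smul_eq_mul]
    _ = _ := by
        rw [Real.sqrt_eq_rpow, ← Real.rpow_mul_natCast hR.le, mul_comm]
        congr 2
        ring

end Symbol

section HeatKernel

variable {E : Type*} [NormedAddCommGroup E]

/-- The heat kernel of the Laplacian on a `d`-dimensional Euclidean space, that is, the density of
the centred Gaussian law with characteristic function `exp (-s |ξ|²)`. -/
noncomputable def heatKernel [Module ℝ E] (s : ℝ) (x : E) : ℝ :=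
  (4 * Real.pi * s) ^ (-((Module.finrank ℝ E : ℝ) / 2)) * Real.exp (-(‖x‖ ^ 2 / (4 * s)))

lemma heatKernel_nonneg [Module ℝ E] {s : ℝ} (hs : 0 ≤ s) (x : E) : 0 ≤ heatKernel s x := by
  unfold heatKernel
  positivity

lemma inv_one_add_le_one_sub_exp_neg_inv {v : ℝ} (hv : 0 < v) :
    (1 + v)⁻¹ ≤ 1 - Real.exp (-v⁻¹) := by
  have hexp : Real.exp (-v⁻¹) ≤ (v⁻¹ + 1)⁻¹ := by
    rw [Real.exp_neg]
    exact inv_anti₀ (by positivity) (Real.add_one_le_exp _)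
  have hsplit : (1 + v)⁻¹ = 1 - (v⁻¹ + 1)⁻¹ := by
    field_simp
    ring
  linarith

lemma rpow_half_mul_one_add_le (n : ℕ) {v : ℝ} (hv : 0 ≤ v) :
    v ^ ((n : ℝ) / 2) * (1 + 4 * v) ≤ 4 * (n + 1).factorial * Real.exp 1 * Real.exp v := by
  have hrpow : v ^ ((n : ℝ) / 2) ≤ (1 + v) ^ n := by
    calc v ^ ((n : ℝ) / 2) ≤ (1 + v) ^ ((n : ℝ) / 2) := by
          gcongr
          linarith
      _ ≤ (1 + v) ^ (n : ℝ) :=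
          Real.rpow_le_rpow_of_exponent_le (by linarith) (half_le_self n.cast_nonneg)
      _ = (1 + v) ^ n := Real.rpow_natCast _ _
  have hexp : (1 + v) ^ (n + 1) ≤ (n + 1).factorial * Real.exp (1 + v) :=
    (div_le_iff₀' (by positivity)).1 (Real.pow_div_factorial_le_exp (1 + v) (by positivity) (n + 1))
  calc v ^ ((n : ℝ) / 2) * (1 + 4 * v) ≤ (1 + v) ^ n * (4 * (1 + v)) := by
        gcongr
        linarith
    _ = 4 * (1 + v) ^ (n + 1) := by ring
    _ ≤ 4 * ((n + 1).factorial * Real.exp (1 + v)) := by gcongr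
    _ = _ := by
        rw [Real.exp_add]
        ring

lemma heatKernel_le_rpow_mul_exp [Module ℝ E] {s : ℝ} (hs : 0 < s) {x : E} (hx : x ≠ 0) :
    heatKernel s x ≤ (‖x‖ ^ 2 / (4 * s)) ^ ((Module.finrank ℝ E : ℝ) / 2) *
      Real.exp (-(‖x‖ ^ 2 / (4 * s))) / ‖x‖ ^ Module.finrank ℝ E := by
  have hr : 0 < ‖x‖ := norm_pos_iff.2 hx
  have hnorm : (‖x‖ ^ 2) ^ ((Module.finrank ℝ E : ℝ) / 2) = ‖x‖ ^ Module.finrank ℝ E := by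
    rw [← Real.rpow_natCast_mul hr.le, Nat.cast_ofNat, mul_div_cancel₀ _ two_ne_zero,
      Real.rpow_natCast]
  have hconst : (4 * Real.pi * s) ^ (-((Module.finrank ℝ E : ℝ) / 2)) ≤
      (‖x‖ ^ 2 / (4 * s)) ^ ((Module.finrank ℝ E : ℝ) / 2) / ‖x‖ ^ Module.finrank ℝ E := by
    rw [← hnorm, ← Real.div_rpow (by positivity) (by positivity), Real.rpow_neg (by positivity),
      ← Real.inv_rpow (by positivity), div_div_cancel_left' (by positivity)]
    gcongr
    linarith [Real.pi_gt_three]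
  rw [heatKernel, mul_div_right_comm]
  gcongr

lemma heatKernel_le_mul_one_sub_exp [Module ℝ E] {s : ℝ} (hs : 0 < s) {x : E} (hx : x ≠ 0) :
    heatKernel s x ≤
      4 * (Module.finrank ℝ E + 1).factorial * Real.exp 1 / ‖x‖ ^ Module.finrank ℝ E *
        (1 - Real.exp (-(‖x‖ ^ (-2 : ℤ) * s))) := by
  have : 0 < ‖x‖ := norm_pos_iff.2 hx
  set n := Module.finrank ℝ E
  set v := ‖x‖ ^ 2 / (4 * s) with hv_def
  have hv : 0 < v := by positivity
  have hu : ‖x‖ ^ (-2 : ℤ) * s = (4 * v)⁻¹ := by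
    rw [hv_def, zpow_neg, zpow_ofNat]
    field_simp
  calc heatKernel s x
      ≤ v ^ ((n : ℝ) / 2) * Real.exp (-v) / ‖x‖ ^ n := heatKernel_le_rpow_mul_exp hs hx
    _ = v ^ ((n : ℝ) / 2) * (1 + 4 * v) * Real.exp (-v) / ‖x‖ ^ n * (1 + 4 * v)⁻¹ := by
        field_simp
    _ ≤ 4 * (n + 1).factorial * Real.exp 1 * Real.exp v * Real.exp (-v) / ‖x‖ ^ n *
          (1 - Real.exp (-(4 * v)⁻¹)) := by
        gcongr ?_ * _ / _ * ?_
        · exact rpow_half_mul_one_add_le n hv.le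
        · exact inv_one_add_le_one_sub_exp_neg_inv (by positivity)
    _ = _ := by
        rw [hu, mul_assoc _ (Real.exp v), ← Real.exp_add, add_neg_cancel, Real.exp_zero, mul_one]

variable [InnerProductSpace ℝ E] [FiniteDimensional ℝ E] [MeasurableSpace E] [BorelSpace E]

lemma integral_cexp_mul_exp_neg_mul_sq_norm {c : ℝ} (hc : 0 < c) (ξ : E) :
    ∫ x : E, Complex.exp ((inner ℝ x ξ : ℝ) * Complex.I) * (Real.exp (-(‖x‖ ^ 2 * c)) : ℂ) =
      (((Real.pi / c) ^ ((Module.finrank ℝ E : ℝ) / 2) *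
        Real.exp (-(‖ξ‖ ^ 2 / (4 * c))) : ℝ) : ℂ) := by
  have h := GaussianFourier.integral_cexp_neg_mul_sq_norm_add (b := (c : ℂ))
    (by rwa [Complex.ofReal_re]) Complex.I ξ
  push_cast [Complex.ofReal_cpow (div_pos Real.pi_pos hc).le]
  convert h using 2
  · ext x
    rw [← Complex.exp_add, real_inner_comm]
    ring_nf
  · rw [Complex.I_sq]
    ring_nf

lemma integrable_exp_neg_mul_sq_norm {c : ℝ} (hc : 0 < c) :
    Integrable fun x : E => Real.exp (-(‖x‖ ^ 2 * c)) := by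
  have h := (GaussianFourier.integrable_cexp_neg_mul_sq_norm_add (b := (c : ℂ))
    (by rwa [Complex.ofReal_re]) 0 (0 : E)).norm
  refine h.congr (Eventually.of_forall fun x => ?_)
  simp [Complex.norm_exp, ← Complex.ofReal_pow, mul_comm]

lemma integrable_heatKernel {s : ℝ} (hs : 0 < s) : Integrable fun x : E => heatKernel s x := by
  unfold heatKernel
  simpa only [div_eq_mul_inv] using
    (integrable_exp_neg_mul_sq_norm (E := E) (c := (4 * s)⁻¹) (by positivity)).const_mul _

lemma integral_cexp_mul_heatKernel {s : ℝ} (hs : 0 < s) (ξ : E) :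
    ∫ x : E, Complex.exp ((inner ℝ x ξ : ℝ) * Complex.I) * (heatKernel s x : ℂ) =
      (Real.exp (-(‖ξ‖ ^ 2 * s)) : ℂ) := by
  have h := integral_cexp_mul_exp_neg_mul_sq_norm (c := (4 * s)⁻¹) (by positivity) ξ
  have hpi : Real.pi / (4 * s)⁻¹ = 4 * Real.pi * s := by
    field_simp
  have hexp : ‖ξ‖ ^ 2 / (4 * (4 * s)⁻¹) = ‖ξ‖ ^ 2 * s := by
    field_simp
  simp_rw [heatKernel, Complex.ofReal_mul, mul_left_comm (Complex.exp _), div_eq_mul_inv (‖_‖ ^ 2)]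
  rw [integral_const_mul, h, hpi, hexp, ← Complex.ofReal_mul, ← mul_assoc,
    ← Real.rpow_add (by positivity), neg_add_cancel, Real.rpow_zero, one_mul]

lemma integral_heatKernel {s : ℝ} (hs : 0 < s) : ∫ x : E, heatKernel s x = 1 := by
  have h := integral_cexp_mul_heatKernel hs (0 : E)
  simp only [inner_zero_right, Complex.ofReal_zero, zero_mul, Complex.exp_zero, one_mul,
    integral_complex_ofReal] at h
  simpa using h

lemma integral_cexp_mul_exp_neg_eq_heatKernel {s : ℝ} (hs : 0 < s) (x : E) :
    ∫ ξ : E, Complex.exp ((inner ℝ ξ x : ℝ) * Complex.I) * (Real.exp (-(‖ξ‖ ^ 2 * s)) : ℂ) =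
      (((2 * Real.pi) ^ Module.finrank ℝ E * heatKernel s x : ℝ) : ℂ) := by
  have hpi : Real.pi / s = (2 * Real.pi) ^ 2 * (4 * Real.pi * s)⁻¹ := by
    field_simp
    ring
  rw [integral_cexp_mul_exp_neg_mul_sq_norm hs, hpi, heatKernel,
    Real.mul_rpow (by positivity) (by positivity), ← Real.rpow_natCast_mul (by positivity),
    Nat.cast_ofNat, mul_div_cancel₀ _ two_ne_zero, Real.rpow_natCast,
    Real.inv_rpow (by positivity), ← Real.rpow_neg (by positivity), mul_assoc]

end HeatKernel

section LaplaceTransform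

variable {ν : Measure ℝ} [IsFiniteMeasure ν]

lemma integrable_exp_neg_mul (hν : ∀ᵐ s ∂ν, 0 ≤ s) {l : ℝ} (hl : 0 ≤ l) :
    Integrable (fun s => Real.exp (-(l * s))) ν := by
  refine (integrable_const (1 : ℝ)).mono' (by fun_prop) ?_
  filter_upwards [hν] with s hs
  rw [Real.norm_of_nonneg (Real.exp_pos _).le, Real.exp_le_one_iff]
  exact neg_nonpos.2 (mul_nonneg hl hs)

lemma ae_pos_of_tendsto_integral_exp (hν : ∀ᵐ s ∂ν, 0 ≤ s)
    (hlim : Tendsto (fun l => ∫ s, Real.exp (-(l * s)) ∂ν) atTop (𝓝 0)) : ∀ᵐ s ∂ν, 0 < s := by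
  have hchernoff (l : ℝ) (hl : 0 < l) : ν.real (Set.Iic 0) ≤ ∫ s, Real.exp (-(l * s)) ∂ν := by
    have h := measure_le_le_exp_mul_mgf (X := id) 0 (neg_nonpos.2 hl.le)
      (by simpa only [neg_mul, id] using integrable_exp_neg_mul hν hl.le)
    simp only [mgf, id, neg_mul, mul_zero, Real.exp_zero, one_mul] at h
    exact h
  have hle : ν.real (Set.Iic 0) ≤ 0 :=
    ge_of_tendsto hlim ((eventually_gt_atTop 0).mono hchernoff)
  have hnull : ν (Set.Iic 0) = 0 := (measureReal_eq_zero_iff).1 (hle.antisymm measureReal_nonneg)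
  exact (measure_eq_zero_iff_ae_notMem.1 hnull).mono fun _ hs => not_le.1 hs

end LaplaceTransform

section HeatMixture

variable {E : Type*} [NormedAddCommGroup E] {ν : Measure ℝ}

/-- The average of the heat kernels over a random time of law `ν`, that is, the density of the
heat flow run up to that time. -/
noncomputable def heatMixture [Module ℝ E] (ν : Measure ℝ) (x : E) : ℝ :=
  ∫ s, heatKernel s x ∂ν

lemma heatMixture_nonneg [Module ℝ E] (hν : ∀ᵐ s ∂ν, 0 < s) (x : E) : 0 ≤ heatMixture ν x :=
  integral_nonneg_of_ae (hν.mono fun _ hs => heatKernel_nonneg hs.le x)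

lemma heatMixture_le_mul_integral [Module ℝ E] [IsFiniteMeasure ν] (hν : ∀ᵐ s ∂ν, 0 < s) {x : E}
    (hx : x ≠ 0) :
    heatMixture ν x ≤
      4 * (Module.finrank ℝ E + 1).factorial * Real.exp 1 / ‖x‖ ^ Module.finrank ℝ E *
        ∫ s, (1 - Real.exp (-(‖x‖ ^ (-2 : ℤ) * s))) ∂ν := by
  have hexp : Integrable (fun s => Real.exp (-(‖x‖ ^ (-2 : ℤ) * s))) ν :=
    integrable_exp_neg_mul (hν.mono fun _ hs => hs.le) (by positivity)
  rw [← integral_const_mul]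
  exact integral_mono_of_nonneg (hν.mono fun _ hs => heatKernel_nonneg hs.le x)
    (((integrable_const _).sub hexp).const_mul _)
    (hν.mono fun _ hs => heatKernel_le_mul_one_sub_exp hs hx)

variable [InnerProductSpace ℝ E] [MeasurableSpace E]

lemma charFun_withDensity_ofReal {ρ : Measure E} {f : E → ℝ}
    (hf : Measurable f) (hf₀ : ∀ x, 0 ≤ f x) (ξ : E) :
    charFun (ρ.withDensity fun x => ENNReal.ofReal (f x)) ξ =
      ∫ x, Complex.exp ((inner ℝ x ξ : ℝ) * Complex.I) * (f x : ℂ) ∂ρ := by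
  rw [charFun_apply, integral_withDensity_eq_integral_toReal_smul hf.ennreal_ofReal (by simp)]
  refine integral_congr_ae (Eventually.of_forall fun x => ?_)
  simp only [ENNReal.toReal_ofReal (hf₀ x), Complex.real_smul, mul_comm]

variable [BorelSpace E]

lemma measurable_uncurry_heatKernel :
    Measurable (Function.uncurry fun (x : E) (s : ℝ) => heatKernel s x) := by
  unfold heatKernel
  fun_prop

lemma measurable_heatMixture [SFinite ν] : Measurable (heatMixture ν : E → ℝ) :=
  measurable_uncurry_heatKernel.stronglyMeasurable.integral_prod_right.measurable

lemma integral_cexp_mul_integral_comm {α : Type*} [MeasurableSpace α]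
    {ρ : Measure E} {κ : Measure α} [SFinite ρ] [SFinite κ] {k : E → α → ℝ}
    (hk : Integrable (Function.uncurry k) (ρ.prod κ)) (ξ : E) :
    ∫ x, Complex.exp ((inner ℝ x ξ : ℝ) * Complex.I) * ((∫ s, k x s ∂κ : ℝ) : ℂ) ∂ρ =
      ∫ s, ∫ x, Complex.exp ((inner ℝ x ξ : ℝ) * Complex.I) * (k x s : ℂ) ∂ρ ∂κ := by
  have hchar : Continuous fun x : E => Complex.exp ((inner ℝ x ξ : ℝ) * Complex.I) := by fun_prop
  have hprod : Integrable (Function.uncurry fun (x : E) (s : α) =>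
      Complex.exp ((inner ℝ x ξ : ℝ) * Complex.I) * (k x s : ℂ)) (ρ.prod κ) :=
    hk.ofReal.bdd_mul (c := 1) (hchar.measurable.comp measurable_fst).aestronglyMeasurable
      (Eventually.of_forall fun _ => (Complex.norm_exp_ofReal_mul_I _).le)
  rw [← integral_integral_swap hprod]
  simp only [integral_const_mul, integral_complex_ofReal]

variable [FiniteDimensional ℝ E] [IsFiniteMeasure ν]

lemma integrable_uncurry_heatKernel (hν : ∀ᵐ s ∂ν, 0 < s) :
    Integrable (Function.uncurry fun (x : E) (s : ℝ) => heatKernel s x) (volume.prod ν) := by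
  rw [integrable_prod_iff' measurable_uncurry_heatKernel.aestronglyMeasurable]
  refine ⟨hν.mono fun s hs => integrable_heatKernel hs, (integrable_const (1 : ℝ)).congr ?_⟩
  filter_upwards [hν] with s hs
  simp_rw [Function.uncurry_apply_pair, Real.norm_of_nonneg (heatKernel_nonneg hs.le _)]
  exact (integral_heatKernel hs).symm

lemma integrable_heatMixture (hν : ∀ᵐ s ∂ν, 0 < s) : Integrable (heatMixture ν : E → ℝ) :=
  (integrable_uncurry_heatKernel hν).integral_prod_left

lemma charFun_withDensity_heatMixture (hν : ∀ᵐ s ∂ν, 0 < s) (ξ : E) :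
    charFun (volume.withDensity fun x => ENNReal.ofReal (heatMixture ν x)) ξ =
      ((∫ s, Real.exp (-(‖ξ‖ ^ 2 * s)) ∂ν : ℝ) : ℂ) := by
  rw [charFun_withDensity_ofReal measurable_heatMixture (heatMixture_nonneg hν)]
  simp only [heatMixture]
  rw [integral_cexp_mul_integral_comm (integrable_uncurry_heatKernel hν),
    ← integral_complex_ofReal]
  exact integral_congr_ae (hν.mono fun s hs => integral_cexp_mul_heatKernel hs ξ)

lemma integral_cexp_mul_laplace_eq_heatMixture (hν : ∀ᵐ s ∂ν, 0 < s)
    (hint : Integrable fun ξ : E => ∫ s, Real.exp (-(‖ξ‖ ^ 2 * s)) ∂ν) (x : E) :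
    ∫ ξ : E, Complex.exp ((inner ℝ ξ x : ℝ) * Complex.I) *
        ((∫ s, Real.exp (-(‖ξ‖ ^ 2 * s)) ∂ν : ℝ) : ℂ) =
      (((2 * Real.pi) ^ Module.finrank ℝ E * heatMixture ν x : ℝ) : ℂ) := by
  have hprod : Integrable (Function.uncurry fun (ξ : E) (s : ℝ) => Real.exp (-(‖ξ‖ ^ 2 * s)))
      (volume.prod ν) := by
    rw [integrable_prod_iff (by fun_prop)]
    refine ⟨Eventually.of_forall fun ξ =>
      integrable_exp_neg_mul (hν.mono fun _ hs => hs.le) (sq_nonneg ‖ξ‖), ?_⟩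
    simpa only [Function.uncurry_apply_pair, Real.norm_of_nonneg (Real.exp_pos _).le] using hint
  rw [integral_cexp_mul_integral_comm hprod, heatMixture, ← integral_const_mul,
    ← integral_complex_ofReal]
  exact integral_congr_ae (hν.mono fun s hs => integral_cexp_mul_exp_neg_eq_heatKernel hs x)

end HeatMixture

section TimeChange

variable {Ω : Type*} [MeasurableSpace Ω] {P : Measure Ω}

lemma integral_comp_index_eq_integral_integral [IsFiniteMeasure P] {ι β : Type*} [Countable ι]
    [MeasurableSpace ι] [MeasurableSingletonClass ι] [TopologicalSpace β] [MeasurableSpace β]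
    [OpensMeasurableSpace β] {Z : ι → Ω → β} {J : Ω → ι} (hZ : ∀ i, Measurable (Z i))
    (hJ : Measurable J) (hind : IndepFun (fun ω i => Z i ω) J P)
    (f : BoundedContinuousFunction β ℂ) :
    ∫ ω, f (Z (J ω) ω) ∂P = ∫ ω, ∫ ω', f (Z (J ω) ω') ∂P ∂P := by
  have hZ' : Measurable fun ω i => Z i ω := measurable_pi_lambda _ hZ
  have heval : Measurable fun p : (ι → β) × ι => f (p.1 p.2) :=
    measurable_from_prod_countable_left fun i =>
      f.continuous.measurable.comp (measurable_pi_apply i)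
  have hint : Integrable (fun p : (ι → β) × ι => f (p.1 p.2))
      ((P.map fun ω i => Z i ω).prod (P.map J)) :=
    (integrable_const ‖f‖).mono' heval.aestronglyMeasurable
      (Eventually.of_forall fun _ => f.norm_coe_le_norm _)
  calc ∫ ω, f (Z (J ω) ω) ∂P
      = ∫ p, f (p.1 p.2) ∂(P.map fun ω => (fun i => Z i ω, J ω)) :=
        (integral_map (hZ'.prodMk hJ).aemeasurable heval.aestronglyMeasurable).symm
    _ = ∫ i, ∫ z, f (z i) ∂(P.map fun ω i => Z i ω) ∂(P.map J) := by
        rw [(indepFun_iff_map_prod_eq_prod_map_map hZ'.aemeasurable hJ.aemeasurable).1 hind,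
          integral_prod_symm _ hint]
    _ = ∫ ω, ∫ z, f (z (J ω)) ∂(P.map fun ω i => Z i ω) ∂P :=
        integral_map hJ.aemeasurable (measurable_of_countable _).aestronglyMeasurable
    _ = ∫ ω, ∫ ω', f (Z (J ω) ω') ∂P ∂P := by
        refine integral_congr_ae (Eventually.of_forall fun ω => ?_)
        exact integral_map hZ'.aemeasurable
          (f.continuous.measurable.comp (measurable_pi_apply (J ω))).aestronglyMeasurable

variable {T : Type*} [PseudoEMetricSpace T] [TopologicalSpace.SeparableSpace T] [MeasurableSpace T]
  [OpensMeasurableSpace T] [Nonempty T]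

lemma tendsto_nearestPt_denseSeq (t : T) :
    Tendsto (fun n => SimpleFunc.nearestPt (TopologicalSpace.denseSeq T) n t) atTop (𝓝 t) :=
  SimpleFunc.tendsto_nearestPt (TopologicalSpace.denseRange_denseSeq T t)

variable {E : Type*} [MeasurableSpace E] {X : T → Ω → E} {τ : Ω → T}

lemma measurable_comp_nearestPt (hX : ∀ t, Measurable (X t)) (hτ : Measurable τ) (n : ℕ) :
    Measurable fun ω => X (SimpleFunc.nearestPt (TopologicalSpace.denseSeq T) n (τ ω)) ω := by
  have h : Measurable fun p : ℕ × Ω => X (TopologicalSpace.denseSeq T p.1) p.2 :=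
    measurable_from_prod_countable_right fun i =>
      hX (TopologicalSpace.denseSeq T i)
  exact h.comp (((SimpleFunc.nearestPtInd _ n).measurable.comp hτ).prodMk measurable_id)

lemma aemeasurable_comp_time [TopologicalSpace E] [TopologicalSpace.PseudoMetrizableSpace E]
    [BorelSpace E] (hX : ∀ t, Measurable (X t)) (hcont : ∀ᵐ ω ∂P, Continuous fun t => X t ω)
    (hτ : Measurable τ) : AEMeasurable (fun ω => X (τ ω) ω) P :=
  aemeasurable_of_tendsto_metrizable_ae atTop
    (fun n => (measurable_comp_nearestPt hX hτ n).aemeasurable)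
    (hcont.mono fun ω hω => (hω.tendsto _).comp (tendsto_nearestPt_denseSeq (τ ω)))

lemma integral_comp_time_eq_integral_integral [IsFiniteMeasure P] [TopologicalSpace E]
    [OpensMeasurableSpace E] (hX : ∀ t, Measurable (X t))
    (hcont : ∀ᵐ ω ∂P, Continuous fun t => X t ω) (hτ : Measurable τ)
    (hind : IndepFun (fun ω t => X t ω) τ P) (f : BoundedContinuousFunction E ℂ) :
    ∫ ω, f (X (τ ω) ω) ∂P = ∫ ω, ∫ ω', f (X (τ ω) ω') ∂P ∂P := by
  let u := TopologicalSpace.denseSeq T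
  have hmean : Continuous fun t => ∫ ω', f (X t ω') ∂P :=
    continuous_of_dominated (bound := fun _ => ‖f‖)
      (fun t => (f.continuous.measurable.comp (hX t)).aestronglyMeasurable)
      (fun _ => Eventually.of_forall fun _ => f.norm_coe_le_norm _) (integrable_const _)
      (hcont.mono fun _ hω => f.continuous.comp hω)
  have happrox (n : ℕ) : ∫ ω, f (X (SimpleFunc.nearestPt u n (τ ω)) ω) ∂P =
      ∫ ω, ∫ ω', f (X (SimpleFunc.nearestPt u n (τ ω)) ω') ∂P ∂P :=
    integral_comp_index_eq_integral_integral (Z := fun i => X (u i)) (fun i => hX (u i))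
      ((SimpleFunc.nearestPtInd u n).measurable.comp hτ)
      (hind.comp (measurable_pi_lambda _ fun i => measurable_pi_apply (u i))
        (SimpleFunc.nearestPtInd u n).measurable) f
  have hleft : Tendsto (fun n => ∫ ω, f (X (SimpleFunc.nearestPt u n (τ ω)) ω) ∂P) atTop
      (𝓝 (∫ ω, f (X (τ ω) ω) ∂P)) := by
    refine tendsto_integral_of_dominated_convergence (fun _ => ‖f‖) (fun n =>
      (f.continuous.measurable.comp (measurable_comp_nearestPt hX hτ n)).aestronglyMeasurable)
      (integrable_const _) (fun n => Eventually.of_forall fun _ => f.norm_coe_le_norm _) ?_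
    filter_upwards [hcont] with ω hω
    exact ((f.continuous.comp hω).tendsto _).comp (tendsto_nearestPt_denseSeq (τ ω))
  have hright : Tendsto (fun n => ∫ ω, ∫ ω', f (X (SimpleFunc.nearestPt u n (τ ω)) ω') ∂P ∂P)
      atTop (𝓝 (∫ ω, ∫ ω', f (X (τ ω) ω') ∂P ∂P)) := by
    refine tendsto_integral_of_dominated_convergence (fun _ => ‖f‖ * P.real Set.univ) (fun n =>
      (hmean.measurable.comp ((SimpleFunc.measurable _).comp hτ)).aestronglyMeasurable)
      (integrable_const _) (fun n => Eventually.of_forall fun _ =>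
        norm_integral_le_of_norm_le_const (Eventually.of_forall fun _ => f.norm_coe_le_norm _))
      (Eventually.of_forall fun ω =>
        (hmean.tendsto _).comp (tendsto_nearestPt_denseSeq (τ ω)))
  exact tendsto_nhds_unique hleft (hright.congr fun n => (happrox n).symm)

lemma charFun_map_comp_time [IsFiniteMeasure P] {E : Type*} [NormedAddCommGroup E]
    [InnerProductSpace ℝ E] [MeasurableSpace E] [BorelSpace E]
    {X : T → Ω → E}
    (hX : ∀ t, Measurable (X t)) (hcont : ∀ᵐ ω ∂P, Continuous fun t => X t ω) (hτ : Measurable τ)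
    (hind : IndepFun (fun ω t => X t ω) τ P) (ξ : E) :
    charFun (P.map fun ω => X (τ ω) ω) ξ = ∫ ω, charFun (P.map (X (τ ω))) ξ ∂P := by
  simp only [charFun_eq_integral_innerProbChar]
  rw [integral_map (aemeasurable_comp_time hX hcont hτ) (by fun_prop),
    integral_comp_time_eq_integral_integral hX hcont hτ hind]
  refine integral_congr_ae (Eventually.of_forall fun ω => ?_)
  exact (integral_map (hX (τ ω)).aemeasurable (by fun_prop)).symm

end TimeChange

section SubordinateProcess

variable {Ω : Type*} [MeasurableSpace Ω] {P : Measure Ω} {d : ℕ}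
  {W : ℝ≥0 → Ω → EuclideanSpace ℝ (Fin d)} {S : ℝ≥0 → Ω → ℝ≥0}

lemma charFun_map_subordinate_sub [IsFiniteMeasure P] (hW : ∀ t, Measurable (W t))
    (hWcont : ∀ᵐ ω ∂P, Continuous fun t => W t ω) (hS : ∀ t, Measurable (S t))
    (hind : IndepFun (fun ω t => W t ω) (fun ω t => S t ω) P) (s t : ℝ≥0)
    (ξ : EuclideanSpace ℝ (Fin d)) :
    charFun (P.map fun ω => subordinate W S t ω - subordinate W S s ω) ξ =
      ∫ ω, charFun (P.map fun ω' => W (S t ω) ω' - W (S s ω) ω') ξ ∂P := by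
  have hind' : IndepFun (fun ω (p : ℝ≥0 × ℝ≥0) => W p.2 ω - W p.1 ω)
      (fun ω => (S s ω, S t ω)) P :=
    hind.comp (φ := fun (w : ℝ≥0 → EuclideanSpace ℝ (Fin d)) (p : ℝ≥0 × ℝ≥0) => w p.2 - w p.1)
      (ψ := fun σ : ℝ≥0 → ℝ≥0 => (σ s, σ t)) (by fun_prop) (by fun_prop)
  exact charFun_map_comp_time (X := fun (p : ℝ≥0 × ℝ≥0) ω => W p.2 ω - W p.1 ω)
    (fun p => (hW p.2).sub (hW p.1)) (hWcont.mono fun ω hω => by fun_prop)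
    ((hS s).prodMk (hS t)) hind' ξ

lemma map_subordinate_sub [IsProbabilityMeasure P] (hW : ∀ t, Measurable (W t))
    (hWcont : ∀ᵐ ω ∂P, Continuous fun t => W t ω)
    (hWchar : ∀ (s t : ℝ≥0) (ξ : EuclideanSpace ℝ (Fin d)),
      charFun (P.map fun ω => W (s + t) ω - W s ω) ξ = Complex.exp (-((t : ℝ) * ‖ξ‖ ^ 2 : ℝ)))
    (hS : ∀ t, Measurable (S t)) (hind : IndepFun (fun ω t => W t ω) (fun ω t => S t ω) P)
    {s t : ℝ≥0} {ν : Measure ℝ} (hν : ∀ᵐ r ∂ν, 0 < r)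
    (hmap : P.map (fun ω => (S t ω : ℝ) - S s ω) = ν) :
    P.map (fun ω => subordinate W S t ω - subordinate W S s ω) =
      volume.withDensity fun x => ENNReal.ofReal (heatMixture ν x) := by
  have hmeas : Measurable fun ω => (S t ω : ℝ) - S s ω := by fun_prop
  have : IsFiniteMeasure ν := hmap ▸ inferInstance
  have := isFiniteMeasure_withDensity_ofReal
    (integrable_heatMixture (E := EuclideanSpace ℝ (Fin d)) hν).hasFiniteIntegral
  refine Measure.ext_of_charFun (funext fun ξ => ?_)
  rw [charFun_withDensity_heatMixture hν, charFun_map_subordinate_sub hW hWcont hS hind, ← hmap,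
    integral_map hmeas.aemeasurable (by fun_prop), ← integral_complex_ofReal]
  have hlt : ∀ᵐ ω ∂P, S s ω < S t ω :=
    (ae_of_ae_map hmeas.aemeasurable (hmap.symm ▸ hν)).mono fun _ h =>
      NNReal.coe_lt_coe.1 (sub_pos.1 h)
  refine integral_congr_ae (hlt.mono fun ω hω => ?_)
  have h := hWchar (S s ω) (S t ω - S s ω) ξ
  rwa [add_tsub_cancel_of_le hω.le, NNReal.coe_sub hω.le, mul_comm, ← Complex.ofReal_neg,
    ← Complex.ofReal_exp] at h

namespace HasLaplaceExponent

variable {φ : ℝ → ℝ} {t : ℝ≥0}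

lemma integral_exp_map (hlap : HasLaplaceExponent S P φ) (hS : Measurable (S t)) (l : ℝ)
    (hl : 0 < l) :
    ∫ r, Real.exp (-(l * r)) ∂(P.map fun ω => (S t ω : ℝ)) = Real.exp (-((t : ℝ) * φ l)) := by
  rw [integral_map (by fun_prop) (by fun_prop)]
  exact hlap t l hl

lemma ae_map_pos [IsFiniteMeasure P] (hlap : HasLaplaceExponent S P φ)
    (htop : Tendsto φ atTop atTop) (ht : 0 < t) (hS : Measurable (S t)) :
    ∀ᵐ r ∂(P.map fun ω => (S t ω : ℝ)), 0 < r := by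
  have hmeas : Measurable fun ω => (S t ω : ℝ) := hS.coe_nnreal_real
  refine ae_pos_of_tendsto_integral_exp ?_ ?_
  · exact (ae_map_iff hmeas.aemeasurable measurableSet_Ici).2
      (Eventually.of_forall fun ω => (S t ω).2)
  · refine (Real.tendsto_exp_neg_atTop_nhds_zero.comp
      (htop.const_mul_atTop (NNReal.coe_pos.2 ht))).congr' ?_
    filter_upwards [eventually_gt_atTop 0] with l hl using (hlap.integral_exp_map hS l hl).symm

end HasLaplaceExponent

end SubordinateProcess

section TransitionDensity

variable {d : ℕ} {φ : ℝ → ℝ} {t : ℝ}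

lemma transitionDensity_le_integral (x : EuclideanSpace ℝ (Fin d)) :
    transitionDensity φ t x ≤
      ∫ ξ : EuclideanSpace ℝ (Fin d), Real.exp (-(t * φ (‖ξ‖ ^ 2))) := by
  have hconst : ((2 * Real.pi) ^ d)⁻¹ ≤ 1 :=
    inv_le_one_of_one_le₀ (one_le_pow₀ (by linarith [Real.pi_gt_three]))
  have hre : (∫ ξ : EuclideanSpace ℝ (Fin d), Complex.exp (Complex.I * (inner ℝ ξ x : ℝ)) *
      (Real.exp (-(t * φ (‖ξ‖ ^ 2))) : ℂ)).re ≤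
      ∫ ξ : EuclideanSpace ℝ (Fin d), Real.exp (-(t * φ (‖ξ‖ ^ 2))) := by
    refine (Complex.re_le_norm _).trans ((norm_integral_le_integral_norm _).trans_eq ?_)
    simp only [norm_mul, Complex.norm_exp_I_mul_ofReal, one_mul, Complex.norm_real,
      Real.norm_of_nonneg (Real.exp_pos _).le]
  calc transitionDensity φ t x
      ≤ ((2 * Real.pi) ^ d)⁻¹ *
        ∫ ξ : EuclideanSpace ℝ (Fin d), Real.exp (-(t * φ (‖ξ‖ ^ 2))) :=
        mul_le_mul_of_nonneg_left hre (by positivity)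
    _ ≤ _ := mul_le_of_le_one_left (integral_nonneg fun _ => (Real.exp_pos _).le) hconst

variable {ν : Measure ℝ} [IsFiniteMeasure ν]

lemma transitionDensity_eq_heatMixture (hd : 1 ≤ d) (hν : ∀ᵐ s ∂ν, 0 < s)
    (hlaplace : ∀ l, 0 < l → ∫ s, Real.exp (-(l * s)) ∂ν = Real.exp (-(t * φ l)))
    (hint : Integrable fun ξ : EuclideanSpace ℝ (Fin d) => Real.exp (-(t * φ (‖ξ‖ ^ 2)))) :
    (transitionDensity φ t : EuclideanSpace ℝ (Fin d) → ℝ) = heatMixture ν := by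
  have : Nonempty (Fin d) := ⟨⟨0, hd⟩⟩
  have hae : (fun ξ : EuclideanSpace ℝ (Fin d) => Real.exp (-(t * φ (‖ξ‖ ^ 2)))) =ᵐ[volume]
      fun ξ => ∫ s, Real.exp (-(‖ξ‖ ^ 2 * s)) ∂ν := by
    filter_upwards [Measure.ae_ne volume 0] with ξ hξ
    exact (hlaplace _ (pow_pos (norm_pos_iff.2 hξ) 2)).symm
  ext x
  have hinv := integral_cexp_mul_laplace_eq_heatMixture hν (hint.congr hae) x
  rw [integral_congr_ae (g := fun ξ : EuclideanSpace ℝ (Fin d) =>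
    Complex.exp (Complex.I * (inner ℝ ξ x : ℝ)) * (Real.exp (-(t * φ (‖ξ‖ ^ 2))) : ℂ))
    (hae.mono fun ξ hξ => by simp only [← hξ, mul_comm Complex.I]),
    finrank_euclideanSpace_fin] at hinv
  rw [transitionDensity, hinv, Complex.ofReal_re, inv_mul_cancel_left₀ (by positivity)]

lemma heatMixture_le_mul_div {ν : Measure ℝ} [IsProbabilityMeasure ν] (hν : ∀ᵐ s ∂ν, 0 < s)
    (hlaplace : ∀ l, 0 < l → ∫ s, Real.exp (-(l * s)) ∂ν = Real.exp (-(t * φ l)))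
    {x : EuclideanSpace ℝ (Fin d)} (hx : x ≠ 0) :
    heatMixture ν x ≤
      4 * (d + 1).factorial * Real.exp 1 * (t * (φ (‖x‖ ^ (-2 : ℤ)) / ‖x‖ ^ d)) := by
  have hl : 0 < ‖x‖ ^ (-2 : ℤ) := zpow_pos (norm_pos_iff.2 hx) _
  have hle := heatMixture_le_mul_integral hν hx
  rw [finrank_euclideanSpace_fin, integral_sub (integrable_const _)
    (integrable_exp_neg_mul (hν.mono fun _ hs => hs.le) hl.le), hlaplace _ hl, integral_const,
    probReal_univ, one_smul] at hle
  calc heatMixture ν x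
      ≤ 4 * (d + 1).factorial * Real.exp 1 / ‖x‖ ^ d *
        (1 - Real.exp (-(t * φ (‖x‖ ^ (-2 : ℤ))))) := hle
    _ ≤ 4 * (d + 1).factorial * Real.exp 1 / ‖x‖ ^ d * (t * φ (‖x‖ ^ (-2 : ℤ))) := by
        gcongr
        linarith [Real.add_one_le_exp (-(t * φ (‖x‖ ^ (-2 : ℤ))))]
    _ = _ := by ring

lemma IsBernsteinWith.exists_transitionDensity_le_mul_rpow {b δ a θ : ℝ} {μ : Measure ℝ}
    (hd : 1 ≤ d) (hφ : IsBernsteinWith φ b μ) (hscal : LowerScaling φ δ a θ) (hδ : 0 < δ)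
    (ha : 0 < a) (hθ : 0 < θ) (hφθ : 0 < φ θ) {T : ℝ} (hT : 0 < T) :
    ∃ C : ℝ, ∀ t : ℝ, 0 < t → t ≤ T →
      Integrable (fun ξ : EuclideanSpace ℝ (Fin d) => Real.exp (-(t * φ (‖ξ‖ ^ 2)))) ∧
      ∀ x : EuclideanSpace ℝ (Fin d),
        transitionDensity φ t x ≤ C * inverse φ t⁻¹ ^ ((d : ℝ) / 2) := by
  have : Nonempty (Fin d) := ⟨⟨0, hd⟩⟩
  obtain ⟨c, hc, hlower⟩ := hφ.exists_mul_rpow_div_inverse_le hscal hδ ha hθ hφθ hT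
  refine ⟨∫ ξ : EuclideanSpace ℝ (Fin d), Real.exp (c - c * ‖ξ‖ ^ (2 * δ)), fun t ht htT => ?_⟩
  have hR : 0 < inverse φ t⁻¹ := hφ.inverse_pos (hscal.tendsto_atTop hδ ha hθ hφθ) (inv_pos.2 ht)
  have hbound := integral_exp_neg_comp_sq_norm_le
    (volume : Measure (EuclideanSpace ℝ (Fin d))) hc hδ hR (hlower t ht htT)
  rw [finrank_euclideanSpace_fin] at hbound
  exact ⟨integrable_exp_neg_comp_sq_norm volume (hφ.continuousOn.const_mul t) hc hδ hR
    (hlower t ht htT), fun x => (transitionDensity_le_integral x).trans hbound⟩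

end TransitionDensity

end SubordinateBM

open SubordinateBM in
theorem corollary3_general {d : ℕ} (hd : 1 ≤ d) {φ : ℝ → ℝ} {b : ℝ} {μ : Measure ℝ}
    (hφ : IsBernsteinWith φ b μ) {δ a θ : ℝ} (hscal : LowerScaling φ δ a θ) (hδ : 0 < δ)
    (ha : 0 < a) (hθ : 0 < θ) (hφθ : 0 < φ θ) {T : ℝ} (hT : 0 < T) :
    ∃ N : ℝ, 0 < N ∧
      ∀ (Ω : Type*) [MeasurableSpace Ω] (P : Measure Ω) [IsProbabilityMeasure P]
        (W : ℝ≥0 → Ω → EuclideanSpace ℝ (Fin d)) (S : ℝ≥0 → Ω → ℝ≥0),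
        (∀ t, Measurable (W t)) → (∀ᵐ ω ∂P, Continuous fun t => W t ω) →
        (∀ (s t : ℝ≥0) (ξ : EuclideanSpace ℝ (Fin d)),
          charFun (P.map fun ω => W (s + t) ω - W s ω) ξ =
            Complex.exp (-((t : ℝ) * ‖ξ‖ ^ 2 : ℝ))) →
        (∀ t, Measurable (S t)) →
        (∀ s t : ℝ≥0,
          P.map (fun ω => (S (s + t) ω : ℝ) - S s ω) = P.map fun ω => (S t ω : ℝ)) →
        HasLaplaceExponent S P φ → IndepFun (fun ω t => W t ω) (fun ω t => S t ω) P →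
        ∀ t : ℝ≥0, 0 < t → (t : ℝ) ≤ T →
          (∀ s : ℝ≥0,
            P.map (fun ω => subordinate W S (s + t) ω - subordinate W S s ω) =
              volume.withDensity fun x => ENNReal.ofReal (transitionDensity φ (t : ℝ) x)) ∧
          ∀ x : EuclideanSpace ℝ (Fin d),
            transitionDensity φ (t : ℝ) x ≤ N * inverse φ (t : ℝ)⁻¹ ^ ((d : ℝ) / 2) ∧
            (x ≠ 0 → transitionDensity φ (t : ℝ) x ≤
              N * min (inverse φ (t : ℝ)⁻¹ ^ ((d : ℝ) / 2))
                ((t : ℝ) * (φ (‖x‖ ^ (-2 : ℤ)) / ‖x‖ ^ d))) := by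
  have htop : Tendsto φ atTop atTop := hscal.tendsto_atTop hδ ha hθ hφθ
  obtain ⟨C, hC⟩ := hφ.exists_transitionDensity_le_mul_rpow hd hscal hδ ha hθ hφθ hT
  set K : ℝ := 4 * (d + 1).factorial * Real.exp 1
  have hN : 0 < max C K := lt_max_of_lt_right (by positivity)
  refine ⟨max C K, hN, fun Ω _ P _ W S hW hWcont hWchar hS hSstat hlap hind t ht htT => ?_⟩
  obtain ⟨hint, hdiag⟩ := hC t ht htT
  have hSmeas : Measurable fun ω => (S t ω : ℝ) := (hS t).coe_nnreal_real
  have hprob := Measure.isProbabilityMeasure_map (μ := P) hSmeas.aemeasurable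
  have hlaw := hlap.integral_exp_map (hS t)
  have hpos := hlap.ae_map_pos htop ht (hS t)
  have hdensity := transitionDensity_eq_heatMixture hd hpos hlaw hint
  have hR : 0 ≤ inverse φ (t : ℝ)⁻¹ := (hφ.inverse_pos htop (by positivity)).le
  have hon (x : EuclideanSpace ℝ (Fin d)) :
      transitionDensity φ t x ≤ max C K * inverse φ (t : ℝ)⁻¹ ^ ((d : ℝ) / 2) :=
    (hdiag x).trans (by gcongr; exact le_max_left C K)
  refine ⟨fun s => ?_, fun x => ⟨hon x, fun hx => ?_⟩⟩
  · rw [hdensity]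
    exact map_subordinate_sub hW hWcont hWchar hS hind hpos (hSstat s t)
  · have hφx : 0 ≤ φ (‖x‖ ^ (-2 : ℤ)) := hφ.nonneg (zpow_pos (norm_pos_iff.2 hx) _)
    rw [mul_min_of_nonneg _ _ hN.le]
    refine le_min (hon x) (hdensity ▸ (heatMixture_le_mul_div hpos hlaw hx).trans ?_)
    gcongr
    exact le_max_right C K

open SubordinateBM in
theorem corollary3 (d : ℕ) (hd : 1 ≤ d) (φ : ℝ → ℝ) (hφ : IsDriftlessBernstein φ)
    (hφ_one : φ 1 = 1) (hH1 : H1 φ) (T : ℝ) (hT : 0 < T) :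
    ∃ N : ℝ, 0 < N ∧
      ∀ (Ω : Type*) [MeasurableSpace Ω] (P : Measure Ω) [IsProbabilityMeasure P]
        (W : ℝ≥0 → Ω → EuclideanSpace ℝ (Fin d)) (S : ℝ≥0 → Ω → ℝ≥0),
        IsBrownianMotion W P → IsSubordinator S P → HasLaplaceExponent S P φ →
        IndepFun (fun ω t => W t ω) (fun ω t => S t ω) P →
        ∀ t : ℝ≥0, 0 < t → (t : ℝ) ≤ T →
          -- `p(t, ·)` is the transition density of `X`
          (∀ s : ℝ≥0,
            P.map (fun ω => subordinate W S (s + t) ω - subordinate W S s ω) =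
              volume.withDensity
                (fun x => ENNReal.ofReal (transitionDensity φ (t : ℝ) x))) ∧
          -- the upper bound; the second term of the minimum is `+∞` at `x = 0`
          ∀ x : EuclideanSpace ℝ (Fin d),
            transitionDensity φ (t : ℝ) x
                ≤ N * (inverse φ (t : ℝ)⁻¹) ^ ((d : ℝ) / 2) ∧
            (x ≠ 0 →
              transitionDensity φ (t : ℝ) x
                ≤ N * min ((inverse φ (t : ℝ)⁻¹) ^ ((d : ℝ) / 2))
                    ((t : ℝ) * (φ (‖x‖ ^ (-2 : ℤ)) / ‖x‖ ^ d))) := by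
  obtain ⟨μ, hμ⟩ := hφ
  obtain ⟨δ₁, _, a₁, _, hδ₁, -, -, ha₁, -, hscal⟩ := hH1
  obtain ⟨N, hN, hbound⟩ := corollary3_general hd hμ (fun l t hl ht => (hscal l t hl ht).1) hδ₁ ha₁
    one_pos (one_pos.trans_eq hφ_one.symm) hT
  exact ⟨N, hN, fun Ω _ P _ W S hW hS => hbound Ω P W S hW.measurable hW.continuous
    hW.charFun_increment hS.measurable hS.stationary⟩
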